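/- \textbf{Lemma (Sard lemma for real valued functions).} All graphs are simple. For a vertex $x$ of a graph $G$, the unit sphere $S(x)$ is the subgraph of $G$ induced by the neighbours of $x$ (not including $x$), and $G-x$ is the subgraph induced by the vertices different from $x$. Contractible graphs are defined inductively: the one-vertex graph is contractible, and a finite graph $G$ is contractible if it has a vertex $x$ such that both $S(x)$ and $G-x$ are contractible. (Evako) $d$-spheres are defined inductively: the empty graph is the only $(-1)$-sphere, there are no $d$-spheres for $d<-1$, and for $d\ge 0$ a $d$-sphere is a finite graph such that every unit sphere $S(x)$ is a $(d-1)$-sphere and such that $G-x$ is contractible for some vertex $x$. A $d$-graph is a finite graph in which every unit sphere is a $(d-1)$-sphere. Let $d\ge 0$, let $G=(V,E)$ be a $d$-graph, let $f:V\to\mathbb{R}$ be an arbitrary function and let $c\in\mathbb{R}$. The level surface $\{f=c\}$ is the graph whose vertices are the simplices (complete subgraphs) $x$ of $G$ on which $f-c$ changes sign, i.e. $x$ contains a vertex where $f-c<0$ and a vertex where $f-c>0$; two different such simplices are joined by an edge if and only if one is contained in the other. Then for every $c\notin f(V)$, the level surface $\{f=c\}$ is either the empty graph or a $(d-1)$-graph.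 -/

import Mathlib

universe u

namespace SimpleGraph

/-- The unit sphere `S(x)`: the subgraph generated by the neighbours of `x` (without `x`). -/
abbrev unitSphere {V : Type u} (G : SimpleGraph V) (x : V) : SimpleGraph (G.neighborSet x) :=
  G.induce (G.neighborSet x)

/-- The subgraph generated by all vertices different from `x`. -/
abbrev removeVertex {V : Type u} (G : SimpleGraph V) (x : V) : SimpleGraph ({x}ᶜ : Set V) :=
  G.induce ({x}ᶜ : Set V)

/-- Contractible graphs: the one-vertex graph is contractible, and `G` is contractible if for some
vertex `x` both `S(x)` and `G` without `x` are contractible.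
Being inductive, this holds for finite non-empty graphs only. -/
inductive IsContractible : ∀ {V : Type u}, SimpleGraph V → Prop
  | point {V : Type u} (G : SimpleGraph V) (hne : Nonempty V) (hss : Subsingleton V) :
      IsContractible G
  | step {V : Type u} (G : SimpleGraph V) (x : V)
      (hS : IsContractible (G.unitSphere x)) (hR : IsContractible (G.removeVertex x)) :
      IsContractible G

/-- Evako `d`-spheres: the empty graph is the `(-1)`-sphere, and for `d ≥ 0` a `d`-sphere is a
finite graph all of whose unit spheres are `(d-1)`-spheres and which becomes contractible after
removal of some vertex. There are no `d`-spheres for `d < -1`. -/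
inductive IsEvakoSphere : ∀ {V : Type u}, ℤ → SimpleGraph V → Prop
  | empty {V : Type u} (G : SimpleGraph V) (he : IsEmpty V) : IsEvakoSphere (-1) G
  | succ {V : Type u} (d : ℤ) (G : SimpleGraph V) (hd : 0 ≤ d) (hfin : Finite V)
      (hS : ∀ x : V, IsEvakoSphere (d - 1) (G.unitSphere x))
      (hR : ∃ x : V, IsContractible (G.removeVertex x)) :
      IsEvakoSphere d G

theorem isEvakoSphere_neg_one_iff {V : Type u} (G : SimpleGraph V) :
    IsEvakoSphere (-1) G ↔ IsEmpty V := by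
  constructor
  · intro h
    cases h with
    | empty _ he => exact he
    | succ _ _ hd => omega
  · exact IsEvakoSphere.empty G

theorem isEvakoSphere_iff {V : Type u} (d : ℤ) (hd : 0 ≤ d) (G : SimpleGraph V) :
    IsEvakoSphere d G ↔ Finite V ∧ (∀ x : V, IsEvakoSphere (d - 1) (G.unitSphere x)) ∧
      ∃ x : V, IsContractible (G.removeVertex x) := by
  constructor
  · intro h
    cases h with
    | empty => omega
    | succ _ _ _ hf hS hR => exact ⟨hf, hS, hR⟩
  · rintro ⟨hf, hS, hR⟩
    exact IsEvakoSphere.succ d G hd hf hS hR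

/-- A `d`-graph: a finite simple graph all of whose unit spheres are `(d-1)`-spheres. -/
def IsDGraph {V : Type u} (d : ℤ) (G : SimpleGraph V) : Prop :=
  Finite V ∧ ∀ x : V, IsEvakoSphere (d - 1) (G.unitSphere x)

/-- The simplices (vertex sets of complete subgraphs) of `G` on which `f - c` changes sign,
i.e. takes both a negative and a positive value. -/
def LevelVertex {V : Type u} (G : SimpleGraph V) (f : V → ℝ) (c : ℝ) : Type u :=
  {s : Finset V // G.IsClique (s : Set V) ∧ (∃ v ∈ s, f v - c < 0) ∧ ∃ v ∈ s, 0 < f v - c}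

/-- The level surface `{f = c}`: two different simplices on which `f - c` changes sign are
adjacent iff one is contained in the other. -/
def levelSurface {V : Type u} (G : SimpleGraph V) (f : V → ℝ) (c : ℝ) :
    SimpleGraph (LevelVertex G f c) where
  Adj x y := x.1 ⊂ y.1 ∨ y.1 ⊂ x.1
  symm := ⟨fun _ _ h => h.symm⟩
  loopless := ⟨fun _ h => h.elim (fun h' => h'.ne rfl) (fun h' => h'.ne rfl)⟩

end SimpleGraph

/-! The unit sphere of a simplex `x` in `{f = c}` is the join of the sign-changing simplices
strictly inside `x` and those strictly containing it.

Below `x` lie the proper faces with vertices on both sides. A hyperplane separating the two classes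
of vertices cuts the simplex in a polytope of dimension |x| - 2, and these faces index its boundary,
a (|x| - 3)-sphere (`sphereOn_mixedFaces`). Above `x` the sign change is automatic, so all larger
cliques occur. They form the barycentric subdivision of the link of `x`, which is a (d - |x|)-sphere
because `G` is a d-graph (`sphereOn_cofaces`, `IsDGraph.sphereOn_link`). The join has dimension (|x|
- 3) + (d - |x|) + 1 = d - 2 (`SphereOn.union`).

Evako's definition also demands contractibility after deleting a vertex. For the order-theoretic
spheres this comes from closure and interior operators, which dismantle a poset onto their fixed
points (`contractibleOn_of_closure`). -/

namespace SimpleGraph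

/-! ### Invariance under isomorphism -/

section Iso

variable {V W : Type u}

/-- An isomorphism restricts to corresponding induced subgraphs. -/
def Iso.restrictInduce {G : SimpleGraph V} {H : SimpleGraph W} (e : G ≃g H) {s : Set V} {t : Set W}
    (h : ∀ v, v ∈ s ↔ e v ∈ t) : G.induce s ≃g H.induce t where
  toEquiv := e.toEquiv.subtypeEquiv h
  map_rel_iff' := e.map_rel_iff'

theorem IsContractible.of_iso {G : SimpleGraph V} (hG : IsContractible G) :
    ∀ {W : Type u} {H : SimpleGraph W}, (G ≃g H) → IsContractible H := by
  induction hG with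
  | point G hne hss =>
    intro W H e
    exact .point H (e.toEquiv.nonempty_congr.1 hne) (e.toEquiv.subsingleton_congr.1 hss)
  | step G x _ _ ihS ihR =>
    intro W H e
    refine .step H (e x) (ihS (e.restrictInduce fun v => ?_)) (ihR (e.restrictInduce fun v => ?_))
    · simp [mem_neighborSet, e.map_adj_iff]
    · simp

theorem IsEvakoSphere.of_iso {d : ℤ} {G : SimpleGraph V} (hG : IsEvakoSphere d G) :
    ∀ {W : Type u} {H : SimpleGraph W}, (G ≃g H) → IsEvakoSphere d H := by
  induction hG with
  | empty G he =>
    intro W H e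
    exact .empty H (e.toEquiv.isEmpty_congr.1 he)
  | succ d G hd hfin _ hR ihS =>
    intro W H e
    refine .succ d H hd (Finite.of_equiv _ e.toEquiv) (fun y => ?_) ?_
    · refine ihS (e.symm y) (e.restrictInduce fun v => ?_)
      rw [mem_neighborSet, mem_neighborSet, ← e.map_adj_iff, e.apply_symm_apply]
    · obtain ⟨x, hx⟩ := hR
      exact ⟨e x, hx.of_iso (e.restrictInduce fun v => by simp)⟩

end Iso

/-! ### Contractible and spherical sets of vertices -/

section Induce

variable {α : Type u} (H : SimpleGraph α)

/-- The unit sphere of a vertex of an induced subgraph is itself induced. -/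
def unitSphereInduceIso (s : Set α) (x : s) :
    (H.induce s).unitSphere x ≃g H.induce (s ∩ H.neighborSet x) where
  toFun v := ⟨v.1.1, v.1.2, v.2⟩
  invFun v := ⟨⟨v.1, v.2.1⟩, v.2.2⟩
  left_inv _ := rfl
  right_inv _ := rfl
  map_rel_iff' := Iff.rfl

/-- Removing a vertex of an induced subgraph yields an induced subgraph. -/
def removeVertexInduceIso (s : Set α) (x : s) :
    (H.induce s).removeVertex x ≃g H.induce (s \ {x.1}) where
  toFun v := ⟨v.1.1, v.1.2, fun h => v.2 (Subtype.ext h)⟩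
  invFun v := ⟨⟨v.1, v.2.1⟩, fun h => v.2.2 (congrArg Subtype.val h)⟩
  left_inv _ := rfl
  right_inv _ := rfl
  map_rel_iff' := Iff.rfl

/-- The set `s` of vertices induces a contractible subgraph. -/
def ContractibleOn (s : Set α) : Prop := IsContractible (H.induce s)

/-- The set `s` of vertices induces an Evako `d`-sphere. -/
def SphereOn (d : ℤ) (s : Set α) : Prop := IsEvakoSphere d (H.induce s)

variable {H}

theorem contractibleOn_singleton (x : α) : H.ContractibleOn {x} :=
  .point _ inferInstance inferInstance

theorem ContractibleOn.step {s : Set α} {x : α} (hx : x ∈ s)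
    (hS : H.ContractibleOn (s ∩ H.neighborSet x)) (hR : H.ContractibleOn (s \ {x})) :
    H.ContractibleOn s :=
  IsContractible.step _ ⟨x, hx⟩ (IsContractible.of_iso hS (H.unitSphereInduceIso s ⟨x, hx⟩).symm)
    (IsContractible.of_iso hR (H.removeVertexInduceIso s ⟨x, hx⟩).symm)

theorem ContractibleOn.cases {s : Set α} (h : H.ContractibleOn s) :
    (∃ x, s = {x}) ∨ ∃ x ∈ s, H.ContractibleOn (s ∩ H.neighborSet x) ∧
      H.ContractibleOn (s \ {x}) := by
  cases h with
  | point _ hne hss =>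
    left
    exact Set.exists_eq_singleton_iff_nonempty_subsingleton.2
      ⟨Set.nonempty_coe_sort.1 hne, Set.subsingleton_coe s |>.1 hss⟩
  | step _ x hS hR =>
    exact .inr ⟨x, x.2, hS.of_iso (H.unitSphereInduceIso s x),
      hR.of_iso (H.removeVertexInduceIso s x)⟩

/-- Keeps every subgraph inside one ambient vertex type, where joins and orders make sense; the
inductive predicate itself changes the type at each step. -/
theorem ContractibleOn.induction [Finite α] 
    {motive : ∀ s : Set α, H.ContractibleOn s → Prop}
    (singleton : ∀ x, motive {x} (contractibleOn_singleton x))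
    (step : ∀ s x (hx : x ∈ s) (hS : H.ContractibleOn (s ∩ H.neighborSet x))
      (hR : H.ContractibleOn (s \ {x})), motive _ hS → motive _ hR → motive s (.step hx hS hR))
    {s : Set α} (h : H.ContractibleOn s) : motive s h := by
  induction hn : s.ncard using Nat.strong_induction_on generalizing s with
  | _ n ih =>
    subst hn
    obtain ⟨x, rfl⟩ | ⟨x, hx, hS, hR⟩ := h.cases
    · exact singleton x
    · refine step s x hx hS hR (ih _ ?_ hS rfl) (ih _ ?_ hR rfl)
      · exact Set.ncard_lt_ncard
          (Set.ssubset_iff_of_subset Set.inter_subset_left |>.2 ⟨x, hx, by simp⟩) (Set.toFinite _)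
      · exact Set.ncard_lt_ncard
          (Set.ssubset_iff_of_subset Set.sdiff_subset |>.2 ⟨x, hx, by simp⟩) (Set.toFinite _)

theorem sphereOn_neg_one_iff {s : Set α} : H.SphereOn (-1) s ↔ s = ∅ := by
  rw [SphereOn, isEvakoSphere_neg_one_iff, Set.isEmpty_coe_sort]

theorem SphereOn.succ [Finite α] {d : ℤ} (hd : 0 ≤ d) {s : Set α}
    (hS : ∀ x ∈ s, H.SphereOn (d - 1) (s ∩ H.neighborSet x)) {x : α} (hx : x ∈ s)
    (hR : H.ContractibleOn (s \ {x})) : H.SphereOn d s :=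
  IsEvakoSphere.succ d _ hd inferInstance
    (fun y => IsEvakoSphere.of_iso (hS y y.2) (H.unitSphereInduceIso s y).symm)
    ⟨⟨x, hx⟩, IsContractible.of_iso hR (H.removeVertexInduceIso s ⟨x, hx⟩).symm⟩

theorem SphereOn.cases {d : ℤ} {s : Set α} (h : H.SphereOn d s) :
    (d = -1 ∧ s = ∅) ∨ (0 ≤ d ∧ (∀ x ∈ s, H.SphereOn (d - 1) (s ∩ H.neighborSet x)) ∧
      ∃ x ∈ s, H.ContractibleOn (s \ {x})) := by
  cases h with
  | empty _ he => exact .inl ⟨rfl, Set.isEmpty_coe_sort.1 he⟩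
  | succ _ _ hd _ hS hR =>
    obtain ⟨x, hx⟩ := hR
    exact .inr ⟨hd, fun y hy => (hS ⟨y, hy⟩).of_iso (H.unitSphereInduceIso s ⟨y, hy⟩),
      x, x.2, hx.of_iso (H.removeVertexInduceIso s x)⟩

/-! ### Joins -/

theorem contractibleOn_insert [Finite α] {a : α} {B : Set α} (h : ∀ b ∈ B, H.Adj a b) :
    H.ContractibleOn (insert a B) := by
  induction hn : B.ncard using Nat.strong_induction_on generalizing B with
  | _ n ih =>
    subst hn
    obtain rfl | ⟨b, hb⟩ := B.eq_empty_or_nonempty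
    · simpa using contractibleOn_singleton a
    have hab := h b hb
    refine ContractibleOn.step (x := b) (.inr hb) ?_ ?_
    · rw [Set.insert_inter_of_mem (show a ∈ H.neighborSet b from hab.symm)]
      refine ih _ (Set.ncard_lt_ncard ?_ (Set.toFinite _)) (fun c hc => h c hc.1) rfl
      exact Set.ssubset_iff_of_subset Set.inter_subset_left |>.2 ⟨b, hb, by simp⟩
    · rw [Set.insert_sdiff_of_notMem _ (show a ∉ ({b} : Set α) from hab.ne)]
      refine ih _ (Set.ncard_lt_ncard ?_ (Set.toFinite _)) (fun c hc => h c hc.1) rfl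
      exact Set.ssubset_iff_of_subset Set.sdiff_subset |>.2 ⟨b, hb, by simp⟩

theorem contractibleOn_of_cone [Finite α] {s : Set α} {a : α} (ha : a ∈ s)
    (h : ∀ b ∈ s, b ≠ a → H.Adj a b) : H.ContractibleOn s := by
  have := contractibleOn_insert (H := H) (a := a) (B := s \ {a}) fun b hb => h b hb.1 hb.2
  rwa [Set.insert_sdiff_singleton, Set.insert_eq_of_mem ha] at this

theorem union_inter_neighborSet {A B : Set α} (h : ∀ a ∈ A, ∀ b ∈ B, H.Adj a b) {x : α}
    (hx : x ∈ A) : (A ∪ B) ∩ H.neighborSet x = (A ∩ H.neighborSet x) ∪ B := by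
  rw [Set.union_inter_distrib_right, Set.inter_eq_left (s := B) (t := H.neighborSet x) |>.2
    fun b hb => h x hx b hb]

theorem union_diff_singleton_of_adj {A B : Set α} (h : ∀ a ∈ A, ∀ b ∈ B, H.Adj a b) {x : α}
    (hx : x ∈ A) : (A ∪ B) \ {x} = (A \ {x}) ∪ B := by
  rw [Set.union_sdiff_distrib, Set.sdiff_singleton_eq_self fun hb => (h x hx x hb).ne rfl]

/-- `A` is dismantled while `B` is carried along; when one point of `A` is left, the join is a cone
over `B`. -/
theorem ContractibleOn.union [Finite α] {A B : Set α} (hA : H.ContractibleOn A)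
    (h : ∀ a ∈ A, ∀ b ∈ B, H.Adj a b) : H.ContractibleOn (A ∪ B) := by
  induction hA using ContractibleOn.induction with
  | singleton x => exact contractibleOn_insert (h x rfl)
  | step s x hx _ _ hS hR =>
    refine .step (.inl hx) ?_ ?_
    · rw [union_inter_neighborSet h hx]
      exact hS fun a ha => h a ha.1
    · rw [union_diff_singleton_of_adj h hx]
      exact hR fun a ha => h a ha.1

/-- The unit sphere of a point in one factor is its unit sphere there joined with the other factor,
so one dimension drops. The empty (-1)-sphere is the unit for joins. -/
theorem SphereOn.union [Finite α] {A B : Set α} {m n : ℤ} (hA : H.SphereOn m A)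
    (hB : H.SphereOn n B) (h : ∀ a ∈ A, ∀ b ∈ B, H.Adj a b) : H.SphereOn (m + n + 1) (A ∪ B) := by
  induction hk : (m + n + 2).toNat using Nat.strong_induction_on generalizing A B m n with
  | _ k ih =>
    subst hk
    obtain ⟨rfl, rfl⟩ | ⟨hm, hSA, x, hx, hR⟩ := hA.cases
    · simpa using hB
    obtain ⟨rfl, rfl⟩ | ⟨hn, hSB, -⟩ := hB.cases
    · simpa using hA
    refine .succ (by omega) ?_ (.inl hx) ?_
    · rintro y (hy | hy)
      · rw [union_inter_neighborSet h hy]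
        convert ih (m - 1 + n + 2).toNat (by omega) (hSA y hy) hB (fun a ha => h a ha.1) rfl
          using 1
        omega
      · rw [Set.union_comm, union_inter_neighborSet (fun b hb a ha => (h a ha b hb).symm) hy,
          Set.union_comm]
        convert ih (m + (n - 1) + 2).toNat (by omega) hA (hSB y hy) (fun a ha b hb => h a ha b hb.1)
          rfl using 1
        omega
    · rw [union_diff_singleton_of_adj h hx]
      exact hR.union fun a ha => h a ha.1

/-- The common neighbourhood of a clique in a sphere is a sphere. -/
theorem SphereOn.link {k : ℤ} {W : Set α} (hW : H.SphereOn k W) (a : Finset α)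
    (ha : H.IsClique (a : Set α)) (haW : ∀ v ∈ a, v ∈ W) :
    H.SphereOn (k - a.card) {w ∈ W | ∀ v ∈ a, H.Adj v w} := by
  classical
  induction a using Finset.induction_on generalizing k W with
  | empty => simpa using hW
  | insert v a hv ih =>
    have hvW := haW v (by simp)
    obtain ⟨rfl, rfl⟩ | ⟨hk, hS, -⟩ := hW.cases
    · exact hvW.elim
    have hcl := isClique_insert.1 (Finset.coe_insert v a ▸ ha)
    -- The common neighbourhood of `insert v a` in `W` is that of `a` in the unit sphere of `v`.
    convert ih (hS v hvW) hcl.1 fun w hw =>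
      ⟨haW w (by simp [hw]), hcl.2 w hw (by rintro rfl; exact hv hw)⟩ using 1
    · rw [Finset.card_insert_of_notMem hv]
      push_cast
      ring
    · ext w
      simp [and_assoc]

end Induce

/-! ### Comparability graphs -/

section Comparability

variable {α : Type u} [PartialOrder α]

/-- Two elements are adjacent iff one is strictly smaller than the other. -/
def comparabilityGraph (α : Type u) [PartialOrder α] : SimpleGraph α where
  Adj x y := x < y ∨ y < x
  symm := ⟨fun _ _ h => h.symm⟩
  loopless := ⟨fun _ h => h.elim (fun h' => h'.ne rfl) (fun h' => h'.ne rfl)⟩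

theorem inter_neighborSet_comparabilityGraph (S : Set α) (x : α) :
    S ∩ (comparabilityGraph α).neighborSet x = {y ∈ S | y < x} ∪ {y ∈ S | x < y} := by
  ext y
  simp only [Set.mem_inter_iff, mem_neighborSet, comparabilityGraph, Set.mem_union,
    Set.mem_ofPred_eq]
  tauto

theorem adj_of_mem_Iio_of_mem_Ioi {S : Set α} {x : α} :
    ∀ a ∈ {y ∈ S | y < x}, ∀ b ∈ {y ∈ S | x < y}, (comparabilityGraph α).Adj a b :=
  fun _ ha _ hb => .inl (ha.2.trans hb.2)

/-- A finite set in a partial order is contractible if its image under a closure operator is. -/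
theorem contractibleOn_of_closure [Finite α] {S : Set α} {r : α → α}
    (mono : ∀ s ∈ S, ∀ t ∈ S, s ≤ t → r s ≤ r t) (maps : ∀ s ∈ S, r s ∈ S)
    (le : ∀ s ∈ S, s ≤ r s) (idem : ∀ s ∈ S, r (r s) = r s)
    (h : (comparabilityGraph α).ContractibleOn {s ∈ S | r s = s}) :
    (comparabilityGraph α).ContractibleOn S := by
  induction hn : S.ncard using Nat.strong_induction_on generalizing S with
  | _ n ih =>
    subst hn
    obtain hS | hS := {s ∈ S | r s ≠ s}.eq_empty_or_nonempty
    · convert h using 1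
      ext s
      refine ⟨fun hs => ⟨hs, ?_⟩, fun hs => hs.1⟩
      by_contra hne
      exact (Set.ext_iff.1 hS s).1 ⟨hs, hne⟩
    -- By maximality every `t > s` is fixed, hence `r s ≤ r t = t`. So the unit sphere of `s` is a
    -- cone with apex `r s`, and `s` can be deleted.
    obtain ⟨s, hs⟩ := (Set.toFinite {s ∈ S | r s ≠ s}).exists_maximal hS
    obtain ⟨hsS, hsr⟩ := hs.prop
    have hlt : s < r s := lt_of_le_of_ne (le s hsS) (Ne.symm hsr)
    refine .step hsS (contractibleOn_of_cone (a := r s) ⟨maps s hsS, .inl hlt⟩ ?_)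
      (ih _ ?_ ?_ ?_ ?_ ?_ ?_ rfl)
    · rintro t ⟨htS, ht | ht⟩ hne
      · have hrt : r t = t := by
          by_contra hrt
          exact hs.not_gt ⟨htS, hrt⟩ ht
        exact .inl (lt_of_le_of_ne (hrt ▸ mono s hsS t htS ht.le) hne.symm)
      · exact .inr (ht.trans hlt)
    · exact Set.ncard_lt_ncard
        (Set.ssubset_iff_of_subset Set.sdiff_subset |>.2 ⟨s, hsS, by simp⟩) (Set.toFinite _)
    · exact fun a ha b hb => mono a ha.1 b hb.1
    · refine fun t ht => ⟨maps t ht.1, fun hts => hsr ?_⟩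
      rw [Set.mem_singleton_iff] at hts
      rw [← hts, idem t ht.1]
    · exact fun t ht => le t ht.1
    · exact fun t ht => idem t ht.1
    · convert h using 1
      ext t
      refine ⟨fun ht => ⟨ht.1.1, ht.2⟩, fun ht => ⟨⟨ht.1, ?_⟩, ht.2⟩⟩
      rintro rfl
      exact hsr ht.2

theorem comparabilityGraph_orderDual :
    (comparabilityGraph αᵒᵈ : SimpleGraph αᵒᵈ) = (comparabilityGraph α : SimpleGraph α) := by
  refine SimpleGraph.ext ?_
  funext x y
  exact propext or_comm

/-- A finite set in a partial order is contractible if its image under an interior operator is. -/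
theorem contractibleOn_of_interior [Finite α] {S : Set α} {r : α → α}
    (mono : ∀ s ∈ S, ∀ t ∈ S, s ≤ t → r s ≤ r t) (maps : ∀ s ∈ S, r s ∈ S)
    (le : ∀ s ∈ S, r s ≤ s) (idem : ∀ s ∈ S, r (r s) = r s)
    (h : (comparabilityGraph α).ContractibleOn {s ∈ S | r s = s}) :
    (comparabilityGraph α).ContractibleOn S := by
  rw [← comparabilityGraph_orderDual] at h ⊢
  exact contractibleOn_of_closure (α := αᵒᵈ) (fun s hs t ht hst => mono t ht s hs hst) maps le idem h

theorem sphereOn_inter_neighborSet [Finite α] {S : Set α} {x : α} {m n d : ℤ}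
    (hm : (comparabilityGraph α).SphereOn m {y ∈ S | y < x})
    (hn : (comparabilityGraph α).SphereOn n {y ∈ S | x < y}) (hd : m + n + 1 = d) :
    (comparabilityGraph α).SphereOn d (S ∩ (comparabilityGraph α).neighborSet x) := by
  rw [inter_neighborSet_comparabilityGraph, ← hd]
  exact hm.union hn adj_of_mem_Iio_of_mem_Ioi

end Comparability

/-! ### Spheres of finite sets -/

section Finset

variable {V : Type u} [Finite V]

/-- The boundary of a simplex, in the interval `(s, x)`, is a sphere. -/
theorem sphereOn_Ioo (s x : Finset V) (h : s ⊂ x) :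
    (comparabilityGraph (Finset V)).SphereOn ((x.card : ℤ) - s.card - 2) (Set.Ioo s x) := by
  classical
  induction hn : x.card - s.card using Nat.strong_induction_on generalizing s x with
  | _ n ih =>
    subst hn
    have hcard := Finset.card_lt_card h
    obtain ⟨p, hpx, hps⟩ := Finset.exists_of_ssubset h
    have hsx : s ⊆ x.erase p := Finset.subset_erase.2 ⟨h.1, hps⟩
    have hpc := Finset.card_erase_of_mem hpx
    obtain h1 | h1 : x.card = s.card + 1 ∨ s.card + 2 ≤ x.card := by omega
    · have : (x.card : ℤ) - s.card - 2 = -1 := by omega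
      rw [this, sphereOn_neg_one_iff, Set.eq_empty_iff_forall_notMem]
      rintro t ⟨h2, h3⟩
      have := Finset.card_lt_card h2
      have := Finset.card_lt_card h3
      omega
    have hmem : x.erase p ∈ Set.Ioo s x := by
      refine ⟨lt_of_le_of_ne hsx fun he => ?_, Finset.erase_ssubset hpx⟩
      rw [← he] at hpc
      omega
    refine .succ (by omega) ?_ hmem ?_
    · rintro t ⟨h2, h3⟩
      have h4 := Finset.card_lt_card h2
      have h5 := Finset.card_lt_card h3
      refine sphereOn_inter_neighborSet (m := (t.card : ℤ) - s.card - 2)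
        (n := (x.card : ℤ) - t.card - 2) ?_ ?_ (by ring)
      · convert ih _ (by omega) s t h2 rfl using 1
        ext u
        exact ⟨fun hu => ⟨hu.1.1, hu.2⟩, fun hu => ⟨⟨hu.1, hu.2.trans h3⟩, hu.2⟩⟩
      · convert ih _ (by omega) t x h3 rfl using 1
        ext u
        exact ⟨fun hu => ⟨hu.2, hu.1.2⟩, fun hu => ⟨⟨h2.trans hu.1, hu.2⟩, hu.1⟩⟩
    -- Only the deleted facet `x.erase p` would be completed to `x` by adding `p`. The fixed points,
    -- the faces containing `p`, form a cone with apex `insert p s`.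
    · refine contractibleOn_of_closure (r := fun t => insert p t) ?_ ?_ ?_ ?_ ?_
      · exact fun a _ b _ hab => Finset.insert_subset_insert p hab
      · rintro t ⟨⟨h2, h3⟩, h4⟩
        refine ⟨⟨h2.trans_le (Finset.subset_insert p t), ?_⟩, ?_⟩
        · refine lt_of_le_of_ne (Finset.insert_subset hpx h3.1) fun he => ?_
          by_cases hpt : p ∈ t
          · rw [Finset.insert_eq_of_mem hpt] at he
            exact h3.ne he
          · exact h4 (by rw [← he, Finset.erase_insert hpt]; rfl)
        · intro he
          have : p ∈ x.erase p := he ▸ Finset.mem_insert_self p t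
          simp at this
      · exact fun t _ => Finset.subset_insert p t
      · intro t _
        simp
      · refine contractibleOn_of_cone (a := insert p s) ?_ ?_
        · refine ⟨⟨⟨Finset.ssubset_insert hps, ?_⟩, ?_⟩, by simp⟩
          · refine lt_of_le_of_ne (Finset.insert_subset hpx h.1) fun he => ?_
            rw [← he, Finset.card_insert_of_notMem hps] at h1
            omega
          · intro he
            have : p ∈ x.erase p := he ▸ Finset.mem_insert_self p s
            simp at this
        · rintro t ⟨⟨⟨h2, h3⟩, h4⟩, h5⟩ hne
          refine .inl (lt_of_le_of_ne (Finset.insert_subset ?_ h2.1) hne.symm)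
          exact Finset.insert_eq_self.1 h5

/-- The proper faces of the simplex `x` containing both a vertex in `P` and one outside `P`. -/
def mixedFaces (P : Set V) (x : Finset V) : Set (Finset V) :=
  {s | s < x ∧ (∃ v ∈ s, v ∈ P) ∧ ∃ v ∈ s, v ∉ P}

omit [Finite V] in
theorem mixedFaces_compl (P : Set V) (x : Finset V) : mixedFaces Pᶜ x = mixedFaces P x := by
  ext s
  simp [mixedFaces, and_comm]

/-- Adding `p` retracts onto the faces through `p`; discarding the other vertices of `P` then leaves
a poset with a largest element, which is a proper face because it misses `q`. -/
theorem contractibleOn_mixedFaces_diff [DecidableEq V] {P : Set V} {x : Finset V} {p q z : V}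
    (hp : p ∈ x) (hpP : p ∈ P) (hq : q ∈ x) (hqP : q ∈ P) (hpq : p ≠ q)
    (hz : z ∈ x) (hzP : z ∉ P) :
    (comparabilityGraph (Finset V)).ContractibleOn (mixedFaces P x \ {x.erase p}) := by
  classical
  refine contractibleOn_of_closure (r := fun t => insert p t) ?_ ?_ ?_ ?_ ?_
  · exact fun a _ b _ hab => Finset.insert_subset_insert p hab
  · rintro t ⟨⟨h3, -, v, hv, hvP⟩, h4⟩
    refine ⟨⟨?_, ⟨p, by simp, hpP⟩, v, by simp [hv], hvP⟩, ?_⟩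
    · refine lt_of_le_of_ne (Finset.insert_subset hp h3.1) fun he => ?_
      by_cases hpt : p ∈ t
      · rw [Finset.insert_eq_of_mem hpt] at he
        exact h3.ne he
      · exact h4 (by rw [← he, Finset.erase_insert hpt]; rfl)
    · intro he
      have : p ∈ x.erase p := he ▸ Finset.mem_insert_self p t
      simp at this
  · exact fun t _ => Finset.subset_insert p t
  · intro t _
    simp
  have key : {s ∈ mixedFaces P x \ {x.erase p} | insert p s = s} =
      {s | s < x ∧ p ∈ s ∧ ∃ v ∈ s, v ∉ P} := by
    ext s
    simp only [mixedFaces, Set.mem_sdiff, Set.mem_ofPred_eq, Set.mem_singleton_iff,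
      Finset.insert_eq_self]
    constructor
    · tauto
    · rintro ⟨h1, h2, h3⟩
      refine ⟨⟨⟨h1, ⟨p, h2, hpP⟩, h3⟩, ?_⟩, h2⟩
      rintro rfl
      simp at h2
  rw [key]
  refine contractibleOn_of_interior (r := fun t => t.filter fun v => v = p ∨ v ∉ P) ?_ ?_ ?_ ?_ ?_
  · exact fun a _ b _ hab => Finset.filter_subset_filter _ hab
  · rintro t ⟨h1, h2, v, hv, hvP⟩
    exact ⟨(Finset.filter_subset _ t).trans_lt h1, by simp [h2], v, by simp [hv, hvP], hvP⟩
  · exact fun t _ => Finset.filter_subset _ t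
  · intro t _
    simp [Finset.filter_filter]
  · refine contractibleOn_of_cone (a := x.filter fun v => v = p ∨ v ∉ P) ?_ ?_
    · refine ⟨⟨Finset.filter_ssubset.2 ⟨q, hq, by simp [hqP, hpq.symm]⟩, by simp [hp], z,
        by simp [hz, hzP], hzP⟩, by simp [Finset.filter_filter]⟩
    · rintro t ⟨⟨h1, -, -⟩, h2⟩ hne
      refine .inr (lt_of_le_of_ne ?_ hne)
      rw [← h2]
      exact Finset.filter_subset_filter _ h1.1

theorem sphereOn_mixedFaces (P : Set V) (x : Finset V) (hP : ∃ v ∈ x, v ∈ P)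
    (hN : ∃ v ∈ x, v ∉ P) :
    (comparabilityGraph (Finset V)).SphereOn ((x.card : ℤ) - 3) (mixedFaces P x) := by
  classical
  induction x using Finset.strongInduction with
  | H x ih =>
    obtain ⟨p, hp, hpP⟩ := hP
    obtain ⟨z, hz, hzP⟩ := hN
    have hpz : p ≠ z := by
      rintro rfl
      exact hzP hpP
    have hsub : {p, z} ⊆ x := by
      simp [Finset.insert_subset_iff, hp, hz]
    have hc2 := Finset.card_pair hpz
    have hc := Finset.card_le_card hsub
    have hunit : ∀ t ∈ mixedFaces P x, (comparabilityGraph (Finset V)).SphereOn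
        ((x.card : ℤ) - 3 - 1)
        (mixedFaces P x ∩ (comparabilityGraph (Finset V)).neighborSet t) := by
      rintro t ⟨h1, ⟨v, hv, hvP⟩, w, hw, hwP⟩
      refine sphereOn_inter_neighborSet (m := (t.card : ℤ) - 3)
        (n := (x.card : ℤ) - t.card - 2) ?_ ?_ (by ring)
      · convert ih t h1 ⟨v, hv, hvP⟩ ⟨w, hw, hwP⟩ using 1
        ext u
        exact ⟨fun hu => ⟨hu.2, hu.1.2⟩, fun hu => ⟨⟨hu.1.trans h1, hu.2⟩, hu.1⟩⟩
      · convert sphereOn_Ioo t x h1 using 1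
        ext u
        exact ⟨fun hu => ⟨hu.2, hu.1.1⟩,
          fun hu => ⟨⟨hu.2, ⟨v, hu.1.1 hv, hvP⟩, w, hu.1.1 hw, hwP⟩, hu.1⟩⟩
    by_cases hx : x ⊆ {p, z}
    · have hxe := Finset.Subset.antisymm hx hsub
      have : (x.card : ℤ) - 3 = -1 := by
        rw [hxe, hc2]
        rfl
      rw [this, sphereOn_neg_one_iff, Set.eq_empty_iff_forall_notMem]
      rintro t ⟨h1, ⟨v, hv, hvP⟩, w, hw, hwP⟩
      have hvw : v ≠ w := by
        rintro rfl
        exact hwP hvP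
      have h2 := Finset.card_le_card (show {v, w} ⊆ t by simp [Finset.insert_subset_iff, hv, hw])
      rw [Finset.card_pair hvw] at h2
      have h3 := Finset.card_lt_card h1
      rw [hxe, hc2] at h3
      omega
    · obtain ⟨q, hq, hqn⟩ := Finset.not_subset.1 hx
      simp only [Finset.mem_insert, Finset.mem_singleton, not_or] at hqn
      have hd : 0 ≤ (x.card : ℤ) - 3 := by
        have h2 := Finset.card_lt_card (Finset.ssubset_iff_subset_ne.2 ⟨hsub, fun h => hx h.ge⟩)
        omega
      -- The third vertex `q` gives one side two vertices; the facet to delete omits the vertex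
      -- paired with `q` on that side.
      by_cases hqP : q ∈ P
      · refine .succ hd hunit (x := x.erase p) ?_
          (contractibleOn_mixedFaces_diff hp hpP hq hqP (Ne.symm hqn.1) hz hzP)
        exact ⟨Finset.erase_ssubset hp, ⟨q, by simp [hq, hqn.1], hqP⟩,
          z, by simp [hz, hpz.symm], hzP⟩
      · refine .succ hd hunit (x := x.erase z) ?_ ?_
        · exact ⟨Finset.erase_ssubset hz, ⟨p, by simp [hp, hpz], hpP⟩,
            q, by simp [hq, hqn.2], hqP⟩
        · rw [← mixedFaces_compl]
          exact contractibleOn_mixedFaces_diff hz hzP hq hqP (Ne.symm hqn.2) hp (not_not.2 hpP)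

/-! ### Refinements of links -/

/-- The cliques strictly containing `x` whose further vertices lie in `W`. -/
def cofaces (G : SimpleGraph V) (x : Finset V) (W : Set V) : Set (Finset V) :=
  {t | G.IsClique (t : Set V) ∧ x < t ∧ ∀ v ∈ t, v ∉ x → v ∈ W}

variable {G : SimpleGraph V} {x : Finset V} {W : Set V}

omit [Finite V] in
theorem insert_mem_cofaces [DecidableEq V] (hx : G.IsClique (x : Set V))
    (hW : ∀ w ∈ W, ∀ v ∈ x, G.Adj v w) {v : V} (hv : v ∈ W) : insert v x ∈ cofaces G x W := by
  refine ⟨?_, Finset.ssubset_insert fun h => (hW v hv v h).ne rfl, fun w hw hwx => ?_⟩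
  · rw [Finset.coe_insert, isClique_insert]
    exact ⟨hx, fun b hb _ => (hW v hv b hb).symm⟩
  · obtain rfl | h := Finset.mem_insert.1 hw
    · exact hv
    · exact (hwx h).elim

/-- Erasing `v` is an interior operator once `insert v x` is gone, the only coface it would send to
`x`. -/
theorem contractibleOn_cofaces_diff [DecidableEq V] {v : V} (hvx : v ∉ x)
    (h : (comparabilityGraph (Finset V)).ContractibleOn (cofaces G x (W \ {v}))) :
    (comparabilityGraph (Finset V)).ContractibleOn (cofaces G x W \ {insert v x}) := by
  refine contractibleOn_of_interior (r := fun t => t.erase v) ?_ ?_ ?_ ?_ ?_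
  · exact fun a _ b _ hab => Finset.erase_subset_erase v hab
  · rintro t ⟨⟨h1, h2, h3⟩, h4⟩
    refine ⟨⟨h1.subset (by simp), ?_, fun w hw => h3 w (Finset.mem_of_mem_erase hw)⟩, ?_⟩
    · refine lt_of_le_of_ne (Finset.subset_erase.2 ⟨h2.1, hvx⟩) fun he => ?_
      by_cases hvt : v ∈ t
      · exact h4 (by rw [he, Finset.insert_erase hvt]; rfl)
      · rw [Finset.erase_eq_of_notMem hvt] at he
        exact h2.ne he
    · intro he
      have : v ∈ t.erase v := he ▸ Finset.mem_insert_self v x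
      simp at this
  · exact fun t _ => Finset.erase_subset v t
  · intro t _
    simp
  · convert h using 1
    ext t
    simp only [cofaces, Set.mem_sdiff, Set.mem_ofPred_eq, Set.mem_singleton_iff,
      Finset.erase_eq_self]
    constructor
    · rintro ⟨⟨⟨h1, h2, h3⟩, -⟩, h5⟩
      refine ⟨h1, h2, fun w hw hwx => ⟨h3 w hw hwx, ?_⟩⟩
      rintro rfl
      exact h5 hw
    · rintro ⟨h1, h2, h3⟩
      have hvt : v ∉ t := fun hvt => (h3 v hvt hvx).2 rfl
      refine ⟨⟨⟨h1, h2, fun w hw hwx => (h3 w hw hwx).1⟩, ?_⟩, hvt⟩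
      rintro rfl
      simp at hvt

omit [Finite V] in
theorem cofaces_above {t : Finset V} (ht : t ∈ cofaces G x W) {a : Finset V}
    (ha : ∀ v, v ∈ t ↔ v ∈ x ∨ v ∈ a) :
    {u ∈ cofaces G x W | t < u} = cofaces G t {w ∈ W | ∀ v ∈ a, G.Adj v w} := by
  obtain ⟨h1, h2, h3⟩ := ht
  ext u
  constructor
  · rintro ⟨⟨h4, h5, h6⟩, h7⟩
    refine ⟨h4, h7, fun w hw hwt => ⟨h6 w hw fun h => hwt (h2.1 h), fun v hv => ?_⟩⟩
    have hvt := (ha v).2 (.inr hv)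
    exact h4 (h7.1 hvt) hw (by rintro rfl; exact hwt hvt)
  · rintro ⟨h4, h5, h6⟩
    refine ⟨⟨h4, h2.trans h5, fun w hw hwx => ?_⟩, h5⟩
    by_cases hwt : w ∈ t
    · exact h3 w hwt hwx
    · exact (h6 w hw hwt).1

/-- Subdivision preserves contractibility: deleting `v` from `W` corresponds to deleting `insert v
x`, whose unit sphere is the same construction over `insert v x`. Hence the induction must let `x`
vary. -/
theorem contractibleOn_cofaces (hWc : G.ContractibleOn W) (x : Finset V)
    (hx : G.IsClique (x : Set V)) (hW : ∀ w ∈ W, ∀ v ∈ x, G.Adj v w) :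
    (comparabilityGraph (Finset V)).ContractibleOn (cofaces G x W) := by
  classical
  induction hWc using ContractibleOn.induction generalizing x with
  | singleton v =>
    have hmem := insert_mem_cofaces hx hW (v := v) rfl
    convert contractibleOn_singleton (insert v x) using 1
    refine Set.eq_singleton_iff_unique_mem.2 ⟨hmem, ?_⟩
    rintro t ⟨h1, h2, h3⟩
    obtain ⟨w, hwt, hwx⟩ := Finset.exists_of_ssubset h2
    obtain rfl : w = v := h3 w hwt hwx
    refine Finset.Subset.antisymm (fun u hu => ?_) (Finset.insert_subset hwt h2.1)
    by_cases hux : u ∈ x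
    · simp [hux]
    · rw [show u = w from h3 u hu hux]
      simp
  | step W v hv _ _ ihS ihR =>
    have hvx : v ∉ x := fun h => (hW v hv v h).ne rfl
    have hmem := insert_mem_cofaces hx hW hv
    refine .step hmem ?_ (contractibleOn_cofaces_diff hvx (ihR x hx fun w hw => hW w hw.1))
    rw [inter_neighborSet_comparabilityGraph, cofaces_above (a := {v}) hmem
      (by simp [or_comm])]
    have hempty : {y ∈ cofaces G x W | y < insert v x} = ∅ := by
      rw [Set.eq_empty_iff_forall_notMem]
      rintro t ⟨⟨-, h1, -⟩, h2⟩
      have h3 := Finset.card_lt_card h1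
      have h4 := Finset.card_lt_card h2
      rw [Finset.card_insert_of_notMem hvx] at h4
      omega
    rw [hempty, Set.empty_union]
    convert ihS (insert v x) hmem.1 ?_ using 2
    · ext w
      simp
    · rintro w ⟨hw, hvw⟩ u hu
      obtain rfl | hu := Finset.mem_insert.1 hu
      · exact hvw
      · exact hW w hw u hu

theorem sphereOn_cofaces {k : ℤ} (hWs : G.SphereOn k W) (x : Finset V)
    (hx : G.IsClique (x : Set V)) (hW : ∀ w ∈ W, ∀ v ∈ x, G.Adj v w) :
    (comparabilityGraph (Finset V)).SphereOn k (cofaces G x W) := by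
  classical
  induction hn : (k + 1).toNat using Nat.strong_induction_on generalizing k W x with
  | _ n ih =>
    subst hn
    obtain ⟨rfl, rfl⟩ | ⟨hk, -, v, hv, hR⟩ := hWs.cases
    · rw [sphereOn_neg_one_iff, Set.eq_empty_iff_forall_notMem]
      rintro t ⟨-, h1, h2⟩
      obtain ⟨w, hwt, hwx⟩ := Finset.exists_of_ssubset h1
      exact h2 w hwt hwx
    have hvx : v ∉ x := fun h => (hW v hv v h).ne rfl
    refine .succ hk ?_ (insert_mem_cofaces hx hW hv) (contractibleOn_cofaces_diff hvx
      (contractibleOn_cofaces hR x hx fun w hw => hW w hw.1))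
    intro t ht
    obtain ⟨h1, h2, h3⟩ := ht
    have hc := Finset.card_sdiff_add_card_eq_card h2.1
    have hlt := Finset.card_lt_card h2
    have ha : ∀ v, v ∈ t ↔ v ∈ x ∨ v ∈ t \ x := fun v => by
      have := @h2.1 v
      simp only [Finset.mem_sdiff]
      tauto
    -- Below `t` is the boundary of the simplex `t \ x`; above it is the subdivided link of `t \ x`
    -- in `W`. The join has dimension `k - 1`.
    refine sphereOn_inter_neighborSet (m := (t.card : ℤ) - x.card - 2)
      (n := k - (t \ x).card) ?_ ?_ (by omega)
    · convert sphereOn_Ioo x t h2 using 1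
      ext u
      refine ⟨fun hu => ⟨hu.1.2.1, hu.2⟩, fun hu => ⟨⟨?_, hu.1, ?_⟩, hu.2⟩⟩
      · exact h1.subset (Finset.coe_subset.2 hu.2.1)
      · exact fun v hv => h3 v (hu.2.1 hv)
    · rw [cofaces_above ⟨h1, h2, h3⟩ ha]
      refine ih (k - (t \ x).card + 1).toNat (by omega) (hWs.link (t \ x) ?_ ?_) t h1 ?_ rfl
      · exact h1.subset (Finset.coe_subset.2 Finset.sdiff_subset)
      · intro v hv
        rw [Finset.mem_sdiff] at hv
        exact h3 v hv.1 hv.2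
      · rintro w ⟨hw, hwa⟩ v hv
        obtain hv | hv := (ha v).1 hv
        · exact hW w hw v hv
        · exact hwa v hv

omit [Finite V] in
theorem IsDGraph.sphereOn_link {d : ℤ} (hG : G.IsDGraph d) (x : Finset V)
    (hx : G.IsClique (x : Set V)) (hne : x.Nonempty) :
    G.SphereOn (d - x.card) {w | ∀ v ∈ x, G.Adj v w} := by
  classical
  obtain ⟨v, hv⟩ := hne
  have h := SphereOn.link (H := G) (hG.2 v) (x.erase v) (hx.subset (by simp)) fun w hw =>
    hx hv (Finset.mem_of_mem_erase hw) (Finset.ne_of_mem_erase hw).symm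
  convert h using 1
  · have := Finset.card_erase_add_one hv
    omega
  · ext w
    constructor
    · exact fun hw => ⟨hw v hv, fun u hu => hw u (Finset.mem_of_mem_erase hu)⟩
    · rintro ⟨hvw, hw⟩ u hu
      by_cases huv : u = v
      · exact huv ▸ hvw
      · exact hw u (Finset.mem_erase.2 ⟨huv, hu⟩)

theorem IsDGraph.levelSurface {d : ℤ} (hG : G.IsDGraph d) (f : V → ℝ) (c : ℝ)
    (hc : c ∉ Set.range f) : (G.levelSurface f c).IsDGraph (d - 1) := by
  refine ⟨inferInstanceAs (Finite {s : Finset V // _}), ?_⟩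
  rintro ⟨x, hx, hneg, hpos⟩
  set L : Set (Finset V) :=
    {s | G.IsClique (s : Set V) ∧ (∃ v ∈ s, f v - c < 0) ∧ ∃ v ∈ s, 0 < f v - c}
  -- Here `c ∉ Set.range f` enters: the negative vertices are exactly the complement of the positive
  -- ones.
  have hnot : ∀ v, f v - c < 0 ↔ v ∉ {v | 0 < f v - c} := fun v => by
    have hv : f v - c ≠ 0 := fun h => hc ⟨v, sub_eq_zero.1 h⟩
    exact ⟨fun h => not_lt.2 h.le, fun h => lt_of_le_of_ne (not_lt.1 h) hv⟩
  suffices h : (comparabilityGraph (Finset V)).SphereOn (d - 1 - 1)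
      (L ∩ (comparabilityGraph (Finset V)).neighborSet x) from
    IsEvakoSphere.of_iso h
      ((comparabilityGraph (Finset V)).unitSphereInduceIso L ⟨x, hx, hneg, hpos⟩).symm
  refine sphereOn_inter_neighborSet (m := (x.card : ℤ) - 3) (n := d - x.card) ?_ ?_ (by ring)
  · convert sphereOn_mixedFaces {v | 0 < f v - c} x hpos (by simpa only [hnot] using hneg) using 1
    ext t
    simp only [L, mixedFaces, ← hnot]
    exact ⟨fun ht => ⟨ht.2, ht.1.2.2, ht.1.2.1⟩,
      fun ht => ⟨⟨hx.subset (Finset.coe_subset.2 ht.1.1), ht.2.2, ht.2.1⟩, ht.1⟩⟩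
  · have hne : x.Nonempty := hneg.imp fun _ h => h.1
    convert sphereOn_cofaces (hG.sphereOn_link x hx hne) x hx (fun w hw => hw) using 1
    ext t
    constructor
    · rintro ⟨⟨h1, -, -⟩, h2⟩
      exact ⟨h1, h2, fun w hw hwx v hv => h1 (h2.1 hv) hw (by rintro rfl; exact hwx hv)⟩
    · rintro ⟨h1, h2, -⟩
      exact ⟨⟨h1, hneg.imp fun v hv => ⟨h2.1 hv.1, hv.2⟩,
        hpos.imp fun v hv => ⟨h2.1 hv.1, hv.2⟩⟩, h2⟩

end Finset

end SimpleGraph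

theorem mainTheorem1 {V : Type*} (d : ℕ) (G : SimpleGraph V)
    (hG : SimpleGraph.IsDGraph (d : ℤ) G) (f : V → ℝ) (c : ℝ) (hc : c ∉ Set.range f) :
    IsEmpty (SimpleGraph.LevelVertex G f c) ∨
      SimpleGraph.IsDGraph ((d : ℤ) - 1) (SimpleGraph.levelSurface G f c) := by
  have := hG.1
  -- `IsDGraph` holds vacuously for the empty graph, so the second alternative always applies.
  exact .inr (hG.levelSurface f c hc)
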